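/- Let $n\in\{2,3\}$, let $\Omega\subset\mathbb R^n$ be a bounded open set, $\Omega_d\subset\Omega$ a measurable subset, $D=\Omega\setminus\Omega_d$, and $\epsilon>0$. Write $H_\epsilon(x)=\{y:|y-x|<\epsilon\}$, $e_{y-x}=(y-x)/|y-x|$, let $\omega_n$ be the volume of the unit ball of $\mathbb R^n$, and let $$S(y,x,u)=\frac{u(y)-u(x)}{|y-x|}\cdot e_{y-x}$$ be the nonlocal strain of a displacement $u$. Let $J\colon\mathbb R\to[0,\infty)$ be bounded, measurable and supported on $[0,1]$, and put $J^\epsilon(r)=J(r/\epsilon)$. Let $g\colon\mathbb R\to\mathbb R$ be three times differentiable, bounded together with its first three derivatives, with $g(0)=0$ and $g(r)>0$ for $r\neq0$, convex on an interval $(r^e,r^c)$ with $r^e<0<r^c$ and concave on $(-\infty,r^e]$ and on $[r^c,\infty)$, with finite limits at $\pm\infty$, and with $\max_r|g''(r)|=g''(0)$. Let $\chi(y,x)\in\{0,1\}$ be a measurable indicator function of intact bonds ($\chi\equiv1$ when no bond is broken). Let $\mathcal V$ be the space of $v\in L^\infty(\Omega,\mathbb R^n)$ with $v=0$ a.e.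 on $\Omega_d$, and $\mathcal B$ the space of $U\in L^\infty(\Omega,\mathbb R^n)$ with $U=0$ a.e. on $D$. For $u\in L^\infty(\Omega,\mathbb R^n)$ define, for $x\in D$, $$\mathcal L'[u]w(x)=-\int_{H_\epsilon(x)\cap\Omega}\chi(y,x)\,\frac{J^\epsilon(|y-x|)}{\epsilon^{n+1}\omega_n}\,g''\!\left(\sqrt{|y-x|}\,S(y,x,u)\right)S(y,x,w)\,e_{y-x}\,dy,$$ extended by $\mathcal L'[u]w(x)=0$ for $x\in\Omega_d$, and the stability tensor $$\mathbb A[u](x)=\int_{H_\epsilon(x)\cap\Omega}\chi(y,x)\,\frac{J^\epsilon(|y-x|)}{\epsilon^{n+1}\omega_n|y-x|}\,g''\!\left(\sqrt{|y-x|}\,S(y,x,u)\right)e_{y-x}\otimes e_{y-x}\,dy .$$ Let $u=v+U$ with $v\in\mathcal V$ and $U\in\mathcal B$. Suppose that 1. $\mathcal L'[u]$, regarded as an operator on the $L^2(\Omega,\mathbb R^n)$ closure of $\mathcal V$, has trivial kernel; 2. there is $\gamma>0$ with $\mathbb A^2[u]-\gamma^2\mathbb I>0$, that is, for almost every $x\in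 D$, $\mathbb A^2[u](x)\xi\cdot\xi-\gamma^2|\xi|^2>0$ for all $\xi\in\mathbb R^n\setminus\{0\}$. Then $\mathcal L'[u]$ is a bounded bijective linear operator from $\mathcal V$ onto $\mathcal V$ (with the $L^\infty$ norm), and its inverse $\mathcal L'[u]^{-1}$ is a bounded operator on $\mathcal V$. -/

import Mathlib

open MeasureTheory Filter Topology

open scoped ENNReal

noncomputable section

namespace Peridynamics

/-- The space `ℝⁿ` with its Euclidean norm. -/
abbrev Space (n : ℕ) := EuclideanSpace ℝ (Fin n)

/-- The influence function: non-negative, bounded, (measurable and) supported on `[0, 1]`. -/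
structure IsInfluenceFunction (J : ℝ → ℝ) : Prop where
  measurable : Measurable J
  nonneg : ∀ r, 0 ≤ J r
  bounded : ∃ C, ∀ r, J r ≤ C
  support : ∀ r, r ∉ Set.Icc (0 : ℝ) 1 → J r = 0

/-- The potential of the cohesive force law: three times differentiable, bounded together with its
first three derivatives, zero exactly at the origin and positive elsewhere, convex on an interval
`(rᵉ, rᶜ)` around `0` and concave on either side of it, with finite limits at `±∞`, and with
`max |g''| = g''(0)`. -/
structure IsCohesivePotential (g : ℝ → ℝ) : Prop where
  differentiable : ∀ k < 3, Differentiable ℝ (iteratedDeriv k g)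
  bounded : ∃ C, ∀ k ≤ 3, ∀ r, |iteratedDeriv k g r| ≤ C
  zero : g 0 = 0
  pos : ∀ r, r ≠ 0 → 0 < g r
  convex_concave : ∃ re rc : ℝ, re < 0 ∧ 0 < rc ∧ ConvexOn ℝ (Set.Ioo re rc) g ∧
    ConcaveOn ℝ (Set.Iic re) g ∧ ConcaveOn ℝ (Set.Ici rc) g
  tendsto_atBot : ∃ C, Tendsto g atBot (𝓝 C)
  tendsto_atTop : ∃ C, Tendsto g atTop (𝓝 C)
  max_deriv : ∀ r, |iteratedDeriv 2 g r| ≤ iteratedDeriv 2 g 0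

variable {n : ℕ}

/-- The unit vector `e_{y-x} = (y - x) / |y - x|`. -/
def bondDir (y x : Space n) : Space n := ‖y - x‖⁻¹ • (y - x)

/-- The nonlocal strain `S(y, x, u) = (u(y) - u(x)) / |y - x| · e_{y-x}`. -/
def strain (u : Space n → Space n) (y x : Space n) : ℝ :=
  inner ℝ (‖y - x‖⁻¹ • (u y - u x)) (bondDir y x)

/-- The volume `ωₙ` of the unit ball of `ℝⁿ`. -/
def unitBallVolume (n : ℕ) : ℝ := (volume (Metric.ball (0 : Space n) 1)).toReal

/-- The scalar bond stiffness
`χ(y, x) J(|y - x| / ε) / (ε ^ (n + 1) ωₙ) g''(√|y - x| S(y, x, u))`,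
where `χ` is the indicator of the intact bonds, i.e. of the complement of the set `broken` of
broken bonds `(y, x)`. -/
def stiffness (ε : ℝ) (J g : ℝ → ℝ) (broken : Set (Space n × Space n))
    (u : Space n → Space n) (y x : Space n) : ℝ :=
  brokenᶜ.indicator (fun _ => (1 : ℝ)) (y, x) *
    (J (‖y - x‖ / ε) / (ε ^ (n + 1) * unitBallVolume n)) *
      iteratedDeriv 2 g (√‖y - x‖ * strain u y x)

/-- The linearized nonlocal force `𝓛'[u] w`: for `x` in `D = Ω \ Ωd` it is
`- ∫_{H_ε(x) ∩ Ω} stiffness(y, x) S(y, x, w) e_{y-x} dy`, and it is extended by `0` outside `D`. -/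
def linForce (ε : ℝ) (J g : ℝ → ℝ) (broken : Set (Space n × Space n)) (Ω Ωd : Set (Space n))
    (u w : Space n → Space n) : Space n → Space n :=
  (Ω \ Ωd).indicator fun x =>
    -∫ y in Metric.ball x ε ∩ Ω, (stiffness ε J g broken u y x * strain w y x) • bondDir y x

/-- The stability tensor
`𝔸[u](x) = ∫_{H_ε(x) ∩ Ω} stiffness(y, x) / |y - x| e_{y-x} ⊗ e_{y-x} dy`, as a matrix. -/
def stabilityTensor (ε : ℝ) (J g : ℝ → ℝ) (broken : Set (Space n × Space n)) (Ω : Set (Space n))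
    (u : Space n → Space n) (x : Space n) : Matrix (Fin n) (Fin n) ℝ :=
  Matrix.of fun i j => ∫ y in Metric.ball x ε ∩ Ω,
    stiffness ε J g broken u y x / ‖y - x‖ * (bondDir y x i * bondDir y x j)

/-- `L^p(Ω, ℝⁿ)` with respect to Lebesgue measure. -/
abbrev LpSpace (p : ℝ≥0∞) (Ω : Set (Space n)) := Lp (Space n) p (volume.restrict Ω)

/-- The closed subspace of `L^∞(Ω, ℝⁿ)` of the fields that vanish almost everywhere on `A`. -/
def vanishingOn (Ω A : Set (Space n)) : Submodule ℝ (LpSpace ∞ Ω) where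
  carrier := {w | ∀ᵐ x ∂volume.restrict Ω, x ∈ A → w x = 0}
  zero_mem' := by
    filter_upwards [Lp.coeFn_zero (Space n) ∞ (volume.restrict Ω)] with x hx _
    simpa using hx
  add_mem' := by
    intro a b ha hb
    change ∀ᵐ x ∂volume.restrict Ω, x ∈ A → (a + b) x = 0
    filter_upwards [Lp.coeFn_add a b, ha, hb] with x hx h1 h2 hxA
    rw [hx, Pi.add_apply, h1 hxA, h2 hxA, add_zero]
  smul_mem' := by
    intro c a ha
    change ∀ᵐ x ∂volume.restrict Ω, x ∈ A → (c • a) x = 0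
    filter_upwards [Lp.coeFn_smul c a, ha] with x hx h1 hxA
    rw [hx, Pi.smul_apply, h1 hxA, smul_zero]

/-- `𝓥`: the essentially bounded displacements that vanish on the interaction domain `Ωd`. -/
abbrev interiorSpace (Ω Ωd : Set (Space n)) : Submodule ℝ (LpSpace ∞ Ω) := vanishingOn Ω Ωd

/-- `𝓑`: the boundary displacements, essentially bounded and zero on the body `D = Ω \ Ωd`. -/
abbrev boundarySpace (Ω Ωd : Set (Space n)) : Submodule ℝ (LpSpace ∞ Ω) :=
  vanishingOn Ω (Ω \ Ωd)

/-- The closure of `𝓥` in `L²(Ω, ℝⁿ)`. -/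
def interiorL2Closure (Ω Ωd : Set (Space n)) : Set (LpSpace 2 Ω) :=
  closure {w | ∃ v ∈ interiorSpace Ω Ωd, w =ᵐ[volume.restrict Ω] v}

end Peridynamics

end

/-! Splitting `w y - w x` in the strain turns the operator into `𝔸 w - K w` on `D`. Here `𝔸` acts as
a bounded matrix multiplier, and `K` is the integral operator whose kernel `bondKernel` has a
singularity of order `|y - x|⁻¹`. Since `𝔸` is symmetric, `𝔸² > γ²` gives `|𝔸 ξ| ≥ γ |ξ|`, so `𝔸⁻¹`
is bounded by `γ⁻¹` and the equation `𝓛'[u] w = f` becomes `w - 𝔸⁻¹ K w = 𝔸⁻¹ f`.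

As `n ≥ 2`, the kernel slices are bounded in `L^{3/2}` uniformly in `x`, so `K` maps `L³` boundedly
into `L^∞`. Two things follow. First, `B = 𝔸⁻¹ K` is compact on `L³`: it is given by an
operator-valued `L³` function, a limit of simple functions, which yield finite-rank operators
(`isCompactOperator_pointwiseOp`). Second, an `L³` solution with bounded right-hand side is itself
bounded. A fixed point of `B` thus lies in `𝓥` and in the kernel of `𝓛'[u]`, so it vanishes. The
Fredholm alternative solves the equation in `L³`, boundedness puts the solution in `𝓥`, and the open
mapping theorem bounds the inverse. -/

noncomputable section

namespace Peridynamics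

/-! ### Compactness of operators given by operator-valued functions, and the Fredholm alternative.
-/

section FredholmTheory

/-- If the slices of a jointly measurable function lie in `L^q`, then they depend measurably on the
parameter as elements of `L^q`. -/
theorem stronglyMeasurable_toLp {α β F : Type*} [MeasurableSpace α] [MeasurableSpace β]
    [NormedAddCommGroup F] [TopologicalSpace.SeparableSpace F] {ν : Measure β} [SFinite ν]
    [IsSeparable ν] {q : ℝ≥0∞} [hq : Fact (1 ≤ q)] [hq' : Fact (q ≠ ∞)] {φ : α → β → F}
    (hφ : StronglyMeasurable (Function.uncurry φ)) (h : ∀ x, MemLp (φ x) q ν) :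
    StronglyMeasurable fun x => (h x).toLp := by
  borelize ↥(Lp F q ν)
  have hdist : ∀ ψ : Lp F q ν, Measurable fun x => edist (h x).toLp ψ := by
    intro ψ
    have heq : ∀ x, edist (h x).toLp ψ = eLpNorm (fun y => φ x y - ψ y) q ν := by
      intro x
      rw [Lp.edist_def]
      refine eLpNorm_congr_ae ?_
      filter_upwards [(h x).coeFn_toLp] with y hy
      simp [hy]
    have hq0 : q ≠ 0 := (zero_lt_one.trans_le hq.out).ne'
    simp only [heq, eLpNorm_eq_lintegral_rpow_enorm_toReal hq0 hq'.out]
    have hm : StronglyMeasurable fun z : α × β => φ z.1 z.2 - ψ z.2 :=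
      hφ.sub ((Lp.stronglyMeasurable ψ).comp_measurable measurable_snd)
    exact (Measurable.lintegral_prod_right (hm.enorm.pow_const _)).pow_const _
  refine Measurable.stronglyMeasurable (measurable_of_isOpen fun s hs => ?_)
  -- `L^q` is separable, so an open set is a countable union of balls, and the preimage of each ball
  -- is measurable by `hdist`.
  choose! r hr hrs using fun f (hf : f ∈ s) => EMetric.mem_nhds_iff.1 (hs.mem_nhds hf)
  obtain ⟨t, -, ht, hts⟩ := TopologicalSpace.isOpen_biUnion_countable s
    (fun f => Metric.eball f (r f)) fun _ _ => Metric.isOpen_eball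
  have hpre : (fun x => (h x).toLp) ⁻¹' s = ⋃ f ∈ t, {x | edist (h x).toLp f < r f} := by
    have hs' : s = ⋃ f ∈ s, Metric.eball f (r f) :=
      (Set.iUnion₂_subset hrs).antisymm' fun f hf =>
        Set.mem_iUnion₂.2 ⟨f, hf, Metric.mem_eball_self (hr f hf)⟩
    rw [hs', ← hts]
    ext x
    simp
  rw [hpre]
  exact .biUnion ht fun f _ => measurableSet_lt (hdist f) measurable_const

variable {α X E : Type*} [MeasurableSpace α] {μ : Measure α} [IsFiniteMeasure μ]
  [NormedAddCommGroup X] [NormedSpace ℝ X] [NormedAddCommGroup E] [NormedSpace ℝ E]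
  {p : ℝ≥0∞} [hp : Fact (1 ≤ p)]

/-- The operator `w ↦ (x ↦ κ x w)` attached to an operator-valued `L^p` function `κ`. -/
def pointwiseOp (κ : Lp (X →L[ℝ] E) p μ) : X →L[ℝ] Lp E p μ :=
  ((ContinuousLinearMap.id ℝ (X →L[ℝ] E)).holderL μ p ∞ p κ).comp (Lp.constL ∞ μ ℝ)

theorem coeFn_pointwiseOp (κ : Lp (X →L[ℝ] E) p μ) (w : X) :
    pointwiseOp κ w =ᵐ[μ] fun x => κ x w := by
  have h1 := ContinuousLinearMap.coeFn_holder (r := p) (ContinuousLinearMap.id ℝ (X →L[ℝ] E)) κ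
    (Lp.const ∞ μ w)
  filter_upwards [h1, Lp.coeFn_const (p := ∞) (μ := μ) w] with x hx hw
  rw [hw] at hx
  exact hx

theorem continuous_pointwiseOp :
    Continuous (pointwiseOp : Lp (X →L[ℝ] E) p μ → X →L[ℝ] Lp E p μ) := by
  unfold pointwiseOp
  fun_prop

theorem pointwiseOp_add (κ₁ κ₂ : Lp (X →L[ℝ] E) p μ) :
    pointwiseOp (κ₁ + κ₂) = pointwiseOp κ₁ + pointwiseOp κ₂ := by
  simp [pointwiseOp, ContinuousLinearMap.add_comp]

/-- For an indicator times a constant the operator factors through the finite-dimensional `E`.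
Simple functions are dense because `p ≠ ∞`, and compact operators form a closed set. -/
theorem isCompactOperator_pointwiseOp [FiniteDimensional ℝ E] (hp' : p ≠ ∞)
    (κ : Lp (X →L[ℝ] E) p μ) : IsCompactOperator (pointwiseOp κ) := by
  have : ProperSpace E := FiniteDimensional.proper_real E
  induction κ using Lp.induction hp' with
  | indicatorConst c hs hμs => 
    rename_i s
    have hc : IsCompactOperator c := (isCompactOperator_of_locallyCompactSpace_dom c)
    let I : E →ₗ[ℝ] Lp E p μ :=
      { toFun := fun e => indicatorConstLp p hs hμs.ne e
        map_add' := fun _ _ => (indicatorConstLp_add ..).symm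
        map_smul' := fun a e => by
          refine Lp.ext ?_
          filter_upwards [indicatorConstLp_coeFn (p := p) (hs := hs) (hμs := hμs.ne) (c := a • e),
            indicatorConstLp_coeFn (p := p) (hs := hs) (hμs := hμs.ne) (c := e),
            Lp.coeFn_smul a (indicatorConstLp p hs hμs.ne e)] with x h1 h2 h3
          simp [h1, h2, h3, Set.indicator_smul_apply] }
    have : (pointwiseOp (Lp.simpleFunc.indicatorConst p hs hμs.ne c : Lp (X →L[ℝ] E) p μ) : X → Lp E p μ) =
        (LinearMap.toContinuousLinearMap I) ∘ c := by
      ext1 w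
      refine Lp.ext ?_
      filter_upwards [coeFn_pointwiseOp (p := p) (indicatorConstLp p hs hμs.ne c) w,
        indicatorConstLp_coeFn (p := p) (hs := hs) (hμs := hμs.ne) (c := c),
        indicatorConstLp_coeFn (p := p) (hs := hs) (hμs := hμs.ne) (c := c w)] with x h1 h2 h3
      refine (h1.trans ?_).trans h3.symm
      by_cases hx : x ∈ s <;> simp [h2, hx]
    rw [this]
    exact hc.clm_comp _
  | add hf hg _ h1 h2 =>
    rw [pointwiseOp_add]
    exact h1.add h2
  | isClosed =>
    exact isClosed_setOfPred_isCompactOperator.preimage continuous_pointwiseOp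

/-- Fredholm alternative: `1` is either an eigenvalue of `K`, excluded by `hinj`, or a point of the
resolvent set. -/
theorem exists_sub_eq_of_injective [CompleteSpace X] {K : X →L[ℝ] X} (hK : IsCompactOperator K)
    (hinj : ∀ w, K w = w → w = 0) (h : X) : ∃ w, w - K w = h := by
  rcases hK.hasEigenvalue_or_mem_resolventSet one_ne_zero with h1 | h1
  · obtain ⟨w, hw⟩ := h1.exists_hasEigenvector
    exact absurd (hinj w (by simpa using hw.apply_eq_smul)) hw.2
  · rw [spectrum.mem_resolventSet_iff] at h1
    obtain ⟨S, hS⟩ := h1.exists_right_inv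
    refine ⟨S h, ?_⟩
    simpa using congrArg (fun L : X →L[ℝ] X => L h) hS

end FredholmTheory

/-! ### Invertibility of a multiplier minus an integral operator on `L^∞`. -/

section Equivalence

variable {α E W : Type*} [MeasurableSpace α] {μ : Measure α} [NormedAddCommGroup E]

theorem ae_norm_le_norm_of_top (w : Lp E ∞ μ) : ∀ᵐ x ∂μ, ‖w x‖ ≤ ‖w‖ := by
  filter_upwards [ae_le_eLpNormEssSup (f := w) (μ := μ)] with x hx
  rw [Lp.norm_def, eLpNorm_exponent_top, ← toReal_enorm]
  refine ENNReal.toReal_mono ?_ hx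
  simpa using Lp.eLpNorm_ne_top w

theorem isClosed_of_mem_iff_ae_eq_zero {S : Set α} {V : Set (Lp E ∞ μ)}
    (hV : ∀ w, w ∈ V ↔ ∀ᵐ x ∂μ, x ∈ S → w x = 0) : IsClosed V := by
  refine IsSeqClosed.isClosed fun w w₀ hw hlim => (hV w₀).2 ?_
  have hbd : ∀ᵐ x ∂μ, ∀ k, x ∈ S → ‖w₀ x‖ ≤ ‖w₀ - w k‖ := by
    refine ae_all_iff.2 fun k => ?_
    filter_upwards [(hV _).1 (hw k), Lp.coeFn_sub w₀ (w k), ae_norm_le_norm_of_top (w₀ - w k)]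
      with x h1 h2 h3 hx
    rwa [h2, Pi.sub_apply, h1 hx, sub_zero] at h3
  have hlim' : Tendsto (fun k => ‖w₀ - w k‖) atTop (𝓝 0) := by
    simpa using (tendsto_const_nhds (x := w₀)).sub hlim |>.norm
  filter_upwards [hbd] with x h1 hx
  exact norm_le_zero_iff.1 (ge_of_tendsto' hlim' fun k => h1 k hx)

theorem stronglyMeasurable_clm_apply {X : Type*} [NormedAddCommGroup X] [NormedSpace ℝ X]
    [NormedSpace ℝ E] {L : α → X →L[ℝ] E} {f : α → X} (hL : StronglyMeasurable L)
    (hf : StronglyMeasurable f) : StronglyMeasurable fun x => L x (f x) := by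
  have h : Continuous fun z : (X →L[ℝ] E) × X => z.1 z.2 := by fun_prop
  exact h.comp_stronglyMeasurable (hL.prodMk hf)

variable [NormedSpace ℝ E] [NormedAddCommGroup W] [NormedSpace ℝ W] {p : ℝ≥0∞} [hp : Fact (1 ≤ p)]

/-- A family of functions that depends linearly on a parameter, up to null sets, and is
essentially bounded by the norm of the parameter defines a bounded operator into `L^∞`. -/
theorem exists_clm_to_top {F : W → α → E} (hm : ∀ w, AEStronglyMeasurable (F w) μ)
    (hadd : ∀ w w', F (w + w') =ᵐ[μ] F w + F w') (hsmul : ∀ (c : ℝ) w, F (c • w) =ᵐ[μ] c • F w)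
    {C : ℝ} (hC : ∀ w, ∀ᵐ x ∂μ, ‖F w x‖ ≤ C * ‖w‖) :
    ∃ T : W →L[ℝ] Lp E ∞ μ, ∀ w, T w =ᵐ[μ] F w := by
  have hmem : ∀ w, MemLp (F w) ∞ μ := fun w => memLp_top_of_bound (hm w) _ (hC w)
  let T : W →ₗ[ℝ] Lp E ∞ μ :=
    { toFun := fun w => (hmem w).toLp
      map_add' := fun w w' => by
        rw [← MemLp.toLp_add]
        exact MemLp.toLp_congr _ _ (hadd w w')
      map_smul' := fun c w => by
        rw [RingHom.id_apply, ← MemLp.toLp_const_smul]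
        exact MemLp.toLp_congr _ _ (hsmul c w) }
  refine ⟨T.mkContinuous (max C 0) fun w => ?_, fun w => (hmem w).coeFn_toLp⟩
  refine (Lp.norm_toLp _ (hmem w)).trans_le ?_
  refine ENNReal.toReal_le_of_le_ofReal (by positivity) ?_
  rw [eLpNorm_exponent_top]
  refine eLpNormEssSup_le_of_ae_bound ?_
  filter_upwards [hC w] with x hx
  exact hx.trans (by gcongr; exact le_max_left _ _)

variable [IsFiniteMeasure μ]

variable (p) in
/-- The inclusion of `L^∞` into `L^p` on a space of finite measure. -/
def lpOfTop : Lp E ∞ μ →L[ℝ] Lp E p μ :=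
  LinearMap.mkContinuous
    { toFun := fun w => ((Lp.memLp w).mono_exponent le_top).toLp
      map_add' := fun w w' => by
        rw [← MemLp.toLp_add]
        exact MemLp.toLp_congr _ _ (Lp.coeFn_add w w')
      map_smul' := fun c w => by
        rw [RingHom.id_apply, ← MemLp.toLp_const_smul]
        exact MemLp.toLp_congr _ _ (Lp.coeFn_smul c w) }
    (measureUnivNNReal μ ^ p.toReal⁻¹) fun w => by
      refine Lp.norm_le_of_ae_bound (norm_nonneg w) ?_
      filter_upwards [MemLp.coeFn_toLp ((Lp.memLp w).mono_exponent (q := ∞) (p := p) le_top),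
        ae_norm_le_norm_of_top w] with x h1 h2
      simpa [h1] using h2

theorem coeFn_lpOfTop (w : Lp E ∞ μ) : lpOfTop p w =ᵐ[μ] w :=
  MemLp.coeFn_toLp ((Lp.memLp w).mono_exponent le_top)

/-- On the space `V` of bounded functions that vanish off `D`, let `𝓛 w = A w - κ w` on `D`, with
`A` an invertible bounded multiplier and `κ` a bounded family of functionals on `L^p`. If `𝓛` is
injective, then it is an isomorphism. -/
theorem exists_continuousLinearEquiv_of_injective [FiniteDimensional ℝ E] (hp' : p ≠ ∞) {D : Set α}
    (hD : MeasurableSet D) {A G : α → E →L[ℝ] E} {κ : α → Lp E p μ →L[ℝ] E}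
    (hAm : StronglyMeasurable A) (hGm : StronglyMeasurable G) (hκm : StronglyMeasurable κ)
    {a b c : ℝ} (hA : ∀ x, ‖A x‖ ≤ a) (hκ : ∀ x, ‖κ x‖ ≤ c)
    (hG : ∀ᵐ x ∂μ, x ∈ D → ‖G x‖ ≤ b ∧ (∀ ξ, G x (A x ξ) = ξ) ∧ ∀ ξ, A x (G x ξ) = ξ)
    {V : Submodule ℝ (Lp E ∞ μ)} (hV : ∀ w, w ∈ V ↔ ∀ᵐ x ∂μ, x ∈ Dᶜ → w x = 0)
    (hinj : ∀ w ∈ V, (∀ᵐ x ∂μ, x ∈ D → A x (w x) = κ x (lpOfTop p w)) → w = 0) :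
    ∃ T : V ≃L[ℝ] V, ∀ w : V, (T w : Lp E ∞ μ) =ᵐ[μ]
      D.indicator fun x => A x ((w : Lp E ∞ μ) x) - κ x (lpOfTop p (w : Lp E ∞ μ)) := by
  have : CompleteSpace E := FiniteDimensional.complete ℝ E
  -- the operator on `L^∞`
  obtain ⟨T, hT⟩ : ∃ T : Lp E ∞ μ →L[ℝ] Lp E ∞ μ, ∀ w, T w =ᵐ[μ]
      D.indicator fun x => A x (w x) - κ x (lpOfTop p w) := by
    refine exists_clm_to_top (C := a + c * ‖(lpOfTop p : Lp E ∞ μ →L[ℝ] Lp E p μ)‖)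
      (fun w => ?_) (fun w w' => ?_) (fun r w => ?_) fun w => ?_
    · exact (((stronglyMeasurable_clm_apply hAm (Lp.stronglyMeasurable w)).sub
        (stronglyMeasurable_clm_apply hκm stronglyMeasurable_const)).indicator hD).aestronglyMeasurable
    · filter_upwards [Lp.coeFn_add w w'] with x hx
      by_cases hxD : x ∈ D
      · simp only [hxD, Set.indicator_of_mem, hx, Pi.add_apply, map_add]
        abel
      · simp [hxD]
    · filter_upwards [Lp.coeFn_smul r w] with x hx
      by_cases hxD : x ∈ D
      · simp only [hxD, Set.indicator_of_mem, hx, Pi.smul_apply, map_smul, smul_sub]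
      · simp [hxD]
    · filter_upwards [ae_norm_le_norm_of_top w] with x hx
      refine (norm_indicator_le_norm_self _ _).trans ((norm_sub_le _ _).trans ?_)
      rw [add_mul, mul_assoc]
      refine add_le_add ((A x).le_of_opNorm_le_of_le (hA x) hx)
        ((κ x).le_of_opNorm_le_of_le (hκ x) ((lpOfTop p).le_opNorm w))
  have hTV : ∀ w, T w ∈ V := fun w => (hV _).2 <| by
    filter_upwards [hT w] with x hx hxD
    rw [hx, Set.indicator_of_notMem hxD]
  -- the compact operator on `L^p`
  obtain ⟨B, hBc, hB⟩ : ∃ B : Lp E p μ →L[ℝ] Lp E p μ, IsCompactOperator B ∧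
      ∀ w, B w =ᵐ[μ] D.indicator fun x => G x (κ x w) := by
    have hmem : MemLp (D.indicator fun x => (G x).comp (κ x)) p μ := by
      -- The sign of `b` is unknown, since `D` may be null; hence `max b 0`.
      refine MemLp.of_bound ?_ (max b 0 * c) ?_
      · have h2 : Continuous fun L : (E →L[ℝ] E) × (Lp E p μ →L[ℝ] E) => L.1.comp L.2 := by
          fun_prop
        exact ((h2.comp_stronglyMeasurable (hGm.prodMk hκm)).indicator hD).aestronglyMeasurable
      · filter_upwards [hG] with x hx
        have hc : 0 ≤ c := (norm_nonneg _).trans (hκ x)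
        by_cases hxD : x ∈ D
        · rw [Set.indicator_of_mem hxD]
          refine (ContinuousLinearMap.opNorm_comp_le _ _).trans ?_
          gcongr
          · exact (hx hxD).1.trans (le_max_left _ _)
          · exact hκ x
        · rw [Set.indicator_of_notMem hxD, norm_zero]
          positivity
    refine ⟨pointwiseOp hmem.toLp, isCompactOperator_pointwiseOp hp' _, fun w => ?_⟩
    filter_upwards [coeFn_pointwiseOp hmem.toLp w, hmem.coeFn_toLp] with x h1 h2
    rw [h1, h2]
    by_cases hxD : x ∈ D <;> simp [hxD]
  -- bootstrapping from `L^p` to `L^∞`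
  have hreg : ∀ (w : Lp E p μ) (f : Lp E ∞ μ),
      (w =ᵐ[μ] D.indicator fun x => G x (f x) + G x (κ x w)) →
      ∃ w' ∈ V, lpOfTop p w' = w ∧ ∀ᵐ x ∂μ, x ∈ D → A x (w' x) = f x + κ x (lpOfTop p w') := by
    intro w f hw
    have hmem : MemLp w ∞ μ := by
      refine memLp_top_of_bound (Lp.aestronglyMeasurable w) (max b 0 * (‖f‖ + c * ‖w‖)) ?_
      filter_upwards [hw, hG, ae_norm_le_norm_of_top f] with x h1 h2 h3
      have hc : 0 ≤ c := (norm_nonneg _).trans (hκ x)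
      rw [h1]
      by_cases hxD : x ∈ D
      · rw [Set.indicator_of_mem hxD, ← map_add]
        exact (G x).le_of_opNorm_le_of_le ((h2 hxD).1.trans (le_max_left _ _))
          ((norm_add_le _ _).trans (add_le_add h3 ((κ x).le_of_opNorm_le (hκ x) w)))
      · rw [Set.indicator_of_notMem hxD, norm_zero]
        positivity
    have hw' : lpOfTop p (hmem.toLp) = w :=
      Lp.ext ((coeFn_lpOfTop _).trans hmem.coeFn_toLp)
    refine ⟨hmem.toLp, (hV _).2 ?_, hw', ?_⟩
    · filter_upwards [hw, hmem.coeFn_toLp] with x h1 h2 hxD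
      rw [h2, h1, Set.indicator_of_notMem hxD]
    · filter_upwards [hw, hmem.coeFn_toLp, hG] with x h1 h2 h3 hxD
      rw [hw', h2, h1, Set.indicator_of_mem hxD, ← map_add, (h3 hxD).2.2]
  have hBinj : ∀ w, B w = w → w = 0 := by
    intro w hw
    obtain ⟨w', hw'V, rfl, hw'⟩ := hreg w 0 <| by
      filter_upwards [hB w, Lp.coeFn_zero E ∞ μ] with x h1 h2
      rw [hw] at h1
      rw [h1]
      by_cases hxD : x ∈ D <;> simp only [hxD, Set.indicator_of_mem, Set.indicator_of_notMem,
        not_false_eq_true, h2, Pi.zero_apply, map_zero, zero_add]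
    rw [hinj w' hw'V, map_zero]
    filter_upwards [hw', Lp.coeFn_zero E ∞ μ] with x h1 h2 hxD
    rw [h1 hxD, h2, Pi.zero_apply, zero_add]
  let TV : V →L[ℝ] V := (T.comp V.subtypeL).codRestrict V fun w => hTV w
  have hVc : IsClosed (V : Set (Lp E ∞ μ)) := isClosed_of_mem_iff_ae_eq_zero hV
  have : CompleteSpace V := hVc.completeSpace_coe
  have hker : TV.ker = ⊥ := by
    refine LinearMap.ker_eq_bot'.2 fun w hw => Subtype.ext (hinj w w.2 ?_)
    have h0 : T w = 0 := congrArg Subtype.val hw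
    filter_upwards [hT w, Lp.coeFn_zero E ∞ μ] with x h1 h2 hxD
    rw [h0, h2, Set.indicator_of_mem hxD] at h1
    exact (sub_eq_zero.1 h1.symm)
  have hrange : TV.range = ⊤ := by
    refine LinearMap.range_eq_top.2 fun f => ?_
    have hmem : MemLp (D.indicator fun x => G x ((f : Lp E ∞ μ) x)) p μ := by
      refine MemLp.of_bound ((stronglyMeasurable_clm_apply hGm (Lp.stronglyMeasurable _)).indicator
        hD).aestronglyMeasurable (max b 0 * ‖f‖) ?_
      filter_upwards [hG, ae_norm_le_norm_of_top (f : Lp E ∞ μ)] with x h1 h2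
      by_cases hxD : x ∈ D
      · rw [Set.indicator_of_mem hxD]
        exact (G x).le_of_opNorm_le_of_le ((h1 hxD).1.trans (le_max_left _ _)) h2
      · rw [Set.indicator_of_notMem hxD, norm_zero]
        positivity
    -- Solve `w - B w = G f` in `L^p`; `hreg` then makes the solution bounded and undoes the
    -- multiplication by `G`.
    obtain ⟨w, hw⟩ := exists_sub_eq_of_injective hBc hBinj hmem.toLp
    obtain ⟨w', hw'V, -, hw'⟩ := hreg w f <| by
      rw [sub_eq_iff_eq_add] at hw
      filter_upwards [hB w, hmem.coeFn_toLp, Lp.coeFn_add hmem.toLp (B w)] with x h1 h2 h3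
      rw [← hw] at h3
      rw [h3, Pi.add_apply, h1, h2]
      by_cases hxD : x ∈ D <;> simp [hxD]
    refine ⟨⟨w', hw'V⟩, Subtype.ext (Lp.ext ?_)⟩
    filter_upwards [hT w', hw', (hV _).1 f.2] with x h1 h2 h3
    refine h1.trans ?_
    by_cases hxD : x ∈ D
    · rw [Set.indicator_of_mem hxD, h2 hxD, add_sub_cancel_right]
    · rw [Set.indicator_of_notMem hxD, h3 hxD]
  -- The open mapping theorem applies because `V` is closed in `L^∞`, hence complete.
  exact ⟨ContinuousLinearEquiv.ofBijective TV hker hrange, fun w => hT w⟩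

end Equivalence

/-! ### Measurable, uniformly bounded inverses of the stability tensor. -/

section Coercive

variable {α E : Type*} [MeasurableSpace α] [NormedAddCommGroup E] [NormedSpace ℝ E]

/-- `Ring.inverse` is continuous on the open set of units and zero elsewhere, hence Borel. -/
theorem stronglyMeasurable_ringInverse [FiniteDimensional ℝ E] {A : α → E →L[ℝ] E}
    (hA : StronglyMeasurable A) : StronglyMeasurable fun x => Ring.inverse (A x) := by
  classical
  have : CompleteSpace E := FiniteDimensional.complete ℝ E
  have h1 : Measurable (Ring.inverse : (E →L[ℝ] E) → E →L[ℝ] E) := by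
    have h2 : (Ring.inverse : (E →L[ℝ] E) → E →L[ℝ] E) =
        Set.piecewise {L | IsUnit L} Ring.inverse 0 := by
      ext1 L
      by_cases hL : IsUnit L
      · simp [hL]
      · simp [hL, Ring.inverse_non_unit]
    rw [h2]
    refine ContinuousOn.measurable_piecewise ?_ continuousOn_const Units.isOpen.measurableSet
    rintro _ ⟨L, rfl⟩
    exact (NormedRing.inverse_continuousAt L).continuousWithinAt
  exact (h1.comp hA.measurable).stronglyMeasurable

theorem ringInverse_of_antilipschitz [FiniteDimensional ℝ E] {L : E →L[ℝ] E} {γ : ℝ} (hγ : 0 < γ)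
    (hL : ∀ ξ, γ * ‖ξ‖ ≤ ‖L ξ‖) :
    ‖Ring.inverse L‖ ≤ γ⁻¹ ∧ (∀ ξ, Ring.inverse L (L ξ) = ξ) ∧ ∀ ξ, L (Ring.inverse L ξ) = ξ := by
  have hinj : Function.Injective L := by
    refine (injective_iff_map_eq_zero L).2 fun ξ hξ => ?_
    have := hL ξ
    rw [hξ, norm_zero] at this
    exact norm_le_zero_iff.1 (nonpos_of_mul_nonpos_right this hγ)
  have hunit : IsUnit L := by
    rw [ContinuousLinearMap.isUnit_iff_bijective]
    exact ⟨hinj, LinearMap.injective_iff_surjective (f := (L : E →ₗ[ℝ] E)) |>.1 hinj⟩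
  have h1 : ∀ ξ, L (Ring.inverse L ξ) = ξ := fun ξ =>
    congrArg (fun S : E →L[ℝ] E => S ξ) (Ring.mul_inverse_cancel L hunit)
  refine ⟨ContinuousLinearMap.opNorm_le_bound _ (by positivity) fun ξ => ?_, fun ξ =>
    congrArg (fun S : E →L[ℝ] E => S ξ) (Ring.inverse_mul_cancel L hunit), h1⟩
  have := hL (Ring.inverse L ξ)
  rw [h1] at this
  rwa [inv_mul_eq_div, le_div_iff₀' hγ]

theorem mul_norm_le_of_posDef {n : ℕ} {T : Matrix (Fin n) (Fin n) ℝ} (hT : T.IsHermitian) {γ : ℝ}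
    (h : (T ^ 2 - γ ^ 2 • (1 : Matrix (Fin n) (Fin n) ℝ)).PosDef) (hγ : 0 < γ) (ξ : Space n) :
    γ * ‖ξ‖ ≤ ‖Matrix.toEuclideanCLM (𝕜 := ℝ) T ξ‖ := by
  refine (sq_le_sq₀ (by positivity) (norm_nonneg _)).1 ?_
  have h1 : 0 ≤ inner ℝ ξ (Matrix.toEuclideanCLM (𝕜 := ℝ)
      (T ^ 2 - γ ^ 2 • (1 : Matrix (Fin n) (Fin n) ℝ)) ξ) := by
    rw [Matrix.inner_toEuclideanCLM]
    simpa using h.posSemidef.dotProduct_mulVec_nonneg ξ.ofLp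
  have hadj : ContinuousLinearMap.adjoint (Matrix.toEuclideanCLM (𝕜 := ℝ) T) =
      Matrix.toEuclideanCLM (𝕜 := ℝ) T := by
    rw [← ContinuousLinearMap.star_eq_adjoint, ← map_star, Matrix.star_eq_conjTranspose, hT.eq]
  rw [map_sub, map_pow, map_smul, map_one, sub_apply, inner_sub_right, pow_two,
    mul_apply_eq_comp, smul_apply, one_apply_eq_self,
    inner_smul_right, real_inner_self_eq_norm_sq] at h1
  -- Symmetry moves one factor across the inner product: `⟪ξ, T² ξ⟫ = ‖T ξ‖²`.
  nth_rw 1 [← hadj] at h1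
  rw [ContinuousLinearMap.adjoint_inner_right, real_inner_self_eq_norm_sq] at h1
  rw [mul_pow]
  linarith

end Coercive

/-! ### The bond kernel: measurability, integrability, and its relation to force and tensor. -/

section Kernel

variable {n : ℕ} {ε : ℝ} {J g : ℝ → ℝ} {broken : Set (Space n × Space n)} {Ω Ωd : Set (Space n)}
  {u w : Space n → Space n}

/-- The matrix-valued kernel
`1_{H_ε(x)}(y) stiffness(y, x) / |y - x| e_{y-x} ⊗ e_{y-x}` of the linearized force. -/
def bondKernel (ε : ℝ) (J g : ℝ → ℝ) (broken : Set (Space n × Space n)) (u : Space n → Space n)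
    (x y : Space n) : Space n →L[ℝ] Space n :=
  (Metric.ball x ε).indicator (fun y => (stiffness ε J g broken u y x / ‖y - x‖) •
    InnerProductSpace.rankOne ℝ (bondDir y x) (bondDir y x)) y

theorem stronglyMeasurable_bondDir :
    StronglyMeasurable fun z : Space n × Space n => bondDir z.2 z.1 := by
  unfold bondDir
  fun_prop

theorem norm_bondDir_le (y x : Space n) : ‖bondDir y x‖ ≤ 1 := by
  rw [bondDir, norm_smul, norm_inv, norm_norm]
  exact inv_mul_le_one

theorem stronglyMeasurable_stiffness (hJ : Measurable J) (hg : Measurable (iteratedDeriv 2 g))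
    (hbroken : MeasurableSet broken) (hu : StronglyMeasurable u) :
    StronglyMeasurable fun z : Space n × Space n => stiffness ε J g broken u z.2 z.1 := by
  have hum : Measurable u := hu.measurable
  have hb : Measurable fun z : Space n × Space n => bondDir z.2 z.1 :=
    stronglyMeasurable_bondDir.measurable
  have hs : Measurable fun z : Space n × Space n => strain u z.2 z.1 := by
    unfold strain
    fun_prop
  have hi : Measurable fun z : Space n × Space n =>
      brokenᶜ.indicator (fun _ => (1 : ℝ)) (z.2, z.1) :=
    (measurable_const.indicator hbroken.compl).comp measurable_swap
  refine Measurable.stronglyMeasurable ?_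
  unfold stiffness
  fun_prop

theorem stronglyMeasurable_bondKernel (hJ : Measurable J) (hg : Measurable (iteratedDeriv 2 g))
    (hbroken : MeasurableSet broken) (hu : StronglyMeasurable u) :
    StronglyMeasurable (Function.uncurry (bondKernel ε J g broken u)) := by
  have h1 : StronglyMeasurable fun z : Space n × Space n =>
      (stiffness ε J g broken u z.2 z.1 / ‖z.2 - z.1‖) •
        InnerProductSpace.rankOne ℝ (bondDir z.2 z.1) (bondDir z.2 z.1) := by
    have h : Continuous fun e : Space n => InnerProductSpace.rankOne ℝ e e := by
      have h0 : Continuous fun e : Space n => innerSL ℝ e := (innerSL ℝ).continuous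
      exact ((ContinuousLinearMap.smulRightL ℝ (Space n) (Space n)).continuous.comp h0).clm_apply
        continuous_id
    have hd : Measurable fun z : Space n × Space n => ‖z.2 - z.1‖ := by fun_prop
    exact ((stronglyMeasurable_stiffness hJ hg hbroken hu).measurable.div hd).stronglyMeasurable.smul
      (h.comp_stronglyMeasurable stronglyMeasurable_bondDir)
  have h2 : MeasurableSet {z : Space n × Space n | z.2 ∈ Metric.ball z.1 ε} := by
    simp only [Metric.mem_ball]
    exact measurableSet_lt (by fun_prop) (by fun_prop)
  exact h1.indicator h2

theorem exists_abs_stiffness_le (hJ : IsInfluenceFunction J) (hg : IsCohesivePotential g) :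
    ∃ C, 0 ≤ C ∧ ∀ y x : Space n, |stiffness ε J g broken u y x| ≤ C := by
  obtain ⟨CJ, hCJ⟩ := hJ.bounded
  obtain ⟨Cg, hCg⟩ := hg.bounded
  have hCJ0 : 0 ≤ CJ := (hJ.nonneg 0).trans (hCJ 0)
  have hCg0 : 0 ≤ Cg := (abs_nonneg _).trans (hCg 0 (by norm_num) 0)
  refine ⟨1 * (CJ / |ε ^ (n + 1) * unitBallVolume n|) * Cg, by positivity, fun y x => ?_⟩
  rw [stiffness, abs_mul, abs_mul, abs_div]
  gcongr
  · refine (norm_indicator_le_norm_self (fun _ => (1 : ℝ)) (y, x)).trans ?_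
    simp
  · rw [abs_of_nonneg (hJ.nonneg _)]
    exact hCJ _
  · exact hCg 2 (by norm_num) _

theorem norm_bondKernel_le {C : ℝ} (hC : ∀ y x : Space n, |stiffness ε J g broken u y x| ≤ C)
    (x y : Space n) :
    ‖bondKernel ε J g broken u x y‖ ≤
      (Metric.ball (0 : Space n) ε).indicator (fun z => C * ‖z‖⁻¹) (y - x) := by
  by_cases hy : y ∈ Metric.ball x ε
  · have hy' : y - x ∈ Metric.ball (0 : Space n) ε := by
      simpa [dist_eq_norm] using hy
    rw [bondKernel, Set.indicator_of_mem hy, Set.indicator_of_mem hy', norm_smul, norm_div,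
      norm_norm, InnerProductSpace.norm_rankOne, div_eq_mul_inv]
    have h1 := norm_bondDir_le y x
    have h2 := hC y x
    have h3 : 0 ≤ C := (abs_nonneg _).trans h2
    calc _ ≤ C * ‖y - x‖⁻¹ * (1 * 1) := by gcongr; exact h2
      _ = _ := by ring
  · have hy' : y - x ∉ Metric.ball (0 : Space n) ε := by
      simpa [dist_eq_norm] using hy
    rw [bondKernel, Set.indicator_of_notMem hy, Set.indicator_of_notMem hy', norm_zero]

/-- `‖z‖ ^ (-q)` is integrable near the origin of `ℝⁿ` when `q < n`. -/
theorem memLp_indicator_ball_norm_inv {q : ℝ≥0∞} (hq : 1 ≤ q) (hq' : q ≠ ∞) (hqn : q.toReal < n)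
    (C : ℝ) :
    MemLp ((Metric.ball (0 : Space n) ε).indicator fun z => C * ‖z‖⁻¹) q volume := by
  have hq0 : q ≠ 0 := (zero_lt_one.trans_le hq).ne'
  have hm : AEStronglyMeasurable (fun z : Space n => ‖z‖⁻¹) := by
    exact Measurable.aestronglyMeasurable (by fun_prop)
  rw [memLp_indicator_iff_restrict measurableSet_ball]
  refine MemLp.const_mul ?_ C
  rw [← integrable_norm_rpow_iff hm.restrict hq0 hq']
  have hn : 1 ≤ Module.finrank ℝ (Space n) := by
    have h1 : 1 ≤ q.toReal := by
      simpa using ENNReal.toReal_mono hq' hq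
    have : (1 : ℝ) < n := h1.trans_lt hqn
    rw [finrank_euclideanSpace_fin]
    exact_mod_cast this.le
  refine integrableOn_ball_of_norm_le_rpow (C := 1) (α := q.toReal) hn (by simpa using hqn) ?_
    (Measurable.aestronglyMeasurable (by fun_prop))
  refine .of_forall fun z => ?_
  rw [one_mul, norm_inv, norm_norm, Real.rpow_neg (norm_nonneg _), Real.inv_rpow (norm_nonneg _)]
  rw [Real.norm_of_nonneg (by positivity)]

/-- The majorant depends only on `y - x`, so translation invariance makes the bound uniform in `x`.
-/
theorem exists_eLpNorm_bondKernel_le (hJ : IsInfluenceFunction J) (hg : IsCohesivePotential g)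
    (hbroken : MeasurableSet broken) (hu : StronglyMeasurable u) {q : ℝ≥0∞} (hq : 1 ≤ q)
    (hq' : q ≠ ∞) (hqn : q.toReal < n) :
    ∃ c : ℝ≥0∞, c ≠ ∞ ∧ ∀ x, MemLp (bondKernel ε J g broken u x) q (volume.restrict Ω) ∧
      eLpNorm (bondKernel ε J g broken u x) q (volume.restrict Ω) ≤ c := by
  obtain ⟨C, hC0, hC⟩ := exists_abs_stiffness_le (ε := ε) (broken := broken) (u := u) hJ hg
  have hb := memLp_indicator_ball_norm_inv (ε := ε) hq hq' hqn C
  have hgm : Measurable (iteratedDeriv 2 g) :=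
    (hg.differentiable 2 (by norm_num)).continuous.measurable
  have hle : ∀ x, eLpNorm (bondKernel ε J g broken u x) q (volume.restrict Ω) ≤
      eLpNorm ((Metric.ball (0 : Space n) ε).indicator fun z => C * ‖z‖⁻¹) q volume := by
    intro x
    rw [← eLpNorm_comp_measurePreserving hb.1 (measurePreserving_sub_right volume x)]
    refine (eLpNorm_mono_measure _ Measure.restrict_le_self).trans (eLpNorm_mono_real fun y => ?_)
    exact norm_bondKernel_le hC x y
  refine ⟨_, hb.2.ne, fun x => ⟨⟨?_, (hle x).trans_lt hb.2⟩, hle x⟩⟩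
  exact ((stronglyMeasurable_bondKernel hJ.measurable hgm hbroken hu).comp_measurable
    measurable_prodMk_left).aestronglyMeasurable

theorem bondKernel_apply (x y ξ : Space n) :
    bondKernel ε J g broken u x y ξ = (Metric.ball x ε).indicator (fun y =>
      (stiffness ε J g broken u y x / ‖y - x‖ * inner ℝ (bondDir y x) ξ) • bondDir y x) y := by
  by_cases hy : y ∈ Metric.ball x ε <;>
    simp [bondKernel, hy, smul_smul]

theorem linForce_eq (x : Space n)
    (h1 : Integrable (bondKernel ε J g broken u x) (volume.restrict Ω))
    (h2 : Integrable (fun y => bondKernel ε J g broken u x y (w y)) (volume.restrict Ω)) :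
    linForce ε J g broken Ω Ωd u w x = (Ω \ Ωd).indicator (fun x =>
      (∫ y in Ω, bondKernel ε J g broken u x y) (w x) -
        ∫ y in Ω, bondKernel ε J g broken u x y (w y)) x := by
  by_cases hx : x ∈ Ω \ Ωd
  · rw [linForce, Set.indicator_of_mem hx, Set.indicator_of_mem hx,
      ContinuousLinearMap.integral_apply h1, ← neg_sub,
      ← integral_sub h2 (h1.apply_continuousLinearMap _), Set.inter_comm, ← setIntegral_indicator measurableSet_ball]
    congr 2
    ext1 y
    rw [← map_sub, bondKernel_apply]
    by_cases hy : y ∈ Metric.ball x ε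
    · rw [Set.indicator_of_mem hy, Set.indicator_of_mem hy, strain, inner_smul_left,
        real_inner_comm]
      congr 1
      simp
      ring
    · rw [Set.indicator_of_notMem hy, Set.indicator_of_notMem hy]
  · rw [linForce, Set.indicator_of_notMem hx, Set.indicator_of_notMem hx]

/-- Lets the kernel hypothesis, stated for `L²` classes, be applied to representatives from `L^∞`.
-/
theorem linForce_congr {w' : Space n → Space n} (h : w =ᵐ[volume.restrict Ω] w') :
    linForce ε J g broken Ω Ωd u w =ᵐ[volume.restrict Ω] linForce ε J g broken Ω Ωd u w' := by
  filter_upwards [h] with x hx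
  by_cases hxD : x ∈ Ω \ Ωd
  · rw [linForce, linForce, Set.indicator_of_mem hxD, Set.indicator_of_mem hxD]
    congr 1
    refine integral_congr_ae ?_
    filter_upwards [ae_restrict_of_ae_restrict_of_subset Set.inter_subset_right h] with y hy
    rw [strain, strain, hx, hy]
  · rw [linForce, linForce, Set.indicator_of_notMem hxD, Set.indicator_of_notMem hxD]

theorem integral_bondKernel (x : Space n)
    (h1 : Integrable (bondKernel ε J g broken u x) (volume.restrict Ω)) :
    ∫ y in Ω, bondKernel ε J g broken u x y =
      Matrix.toEuclideanCLM (𝕜 := ℝ) (stabilityTensor ε J g broken Ω u x) := by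
  apply ContinuousLinearMap.coe_injective
  refine (EuclideanSpace.basisFun (Fin n) ℝ).toBasis.ext fun j => ?_
  ext i
  have h2 : (∫ y in Ω, bondKernel ε J g broken u x y) (EuclideanSpace.single j 1) i =
      ∫ y in Ω, bondKernel ε J g broken u x y (EuclideanSpace.single j 1) i := by
    rw [ContinuousLinearMap.integral_apply h1]
    exact ((EuclideanSpace.proj i : Space n →L[ℝ] ℝ).integral_comp_comm
      (h1.apply_continuousLinearMap _)).symm
  have h3 : Matrix.toEuclideanCLM (𝕜 := ℝ) (stabilityTensor ε J g broken Ω u x)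
      (EuclideanSpace.single j 1) i = stabilityTensor ε J g broken Ω u x i j := by
    simp [Matrix.ofLp_toEuclideanCLM]
  simp only [OrthonormalBasis.coe_toBasis, EuclideanSpace.basisFun_apply,
    ContinuousLinearMap.coe_coe]
  rw [h2, h3, stabilityTensor, Matrix.of_apply, Set.inter_comm,
    ← setIntegral_indicator measurableSet_ball]
  congr 1
  ext1 y
  rw [bondKernel_apply]
  by_cases hy : y ∈ Metric.ball x ε
  · rw [Set.indicator_of_mem hy, Set.indicator_of_mem hy]
    simp [EuclideanSpace.inner_single_right]
    ring
  · rw [Set.indicator_of_notMem hy, Set.indicator_of_notMem hy]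
    rfl

theorem isHermitian_stabilityTensor (x : Space n) :
    (stabilityTensor ε J g broken Ω u x).IsHermitian := by
  ext i j
  simp [stabilityTensor, mul_comm]

end Kernel

/-! ### Application to the linearized force. -/

instance holderConjugate_three_halves : ENNReal.HolderConjugate (3 / 2) 3 where
  inv_add_inv_eq_inv := by
    rw [ENNReal.inv_div (by simp) (by simp), inv_one, ← one_div, ENNReal.div_add_div_same]
    norm_num
    exact ENNReal.div_self (by simp) (by simp)

theorem exists_equiv_linForce {n : ℕ} (hn : 2 ≤ n) {Ω Ωd : Set (Space n)} (hΩ : MeasurableSet Ω)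
    (hΩb : Bornology.IsBounded Ω) (hΩdm : MeasurableSet Ωd) {ε : ℝ} {J : ℝ → ℝ}
    (hJ : IsInfluenceFunction J) {g : ℝ → ℝ} (hg : IsCohesivePotential g)
    {broken : Set (Space n × Space n)} (hbroken : MeasurableSet broken)
    {u : Space n → Space n} (hu : StronglyMeasurable u)
    (hker : ∀ w ∈ interiorL2Closure Ω Ωd,
      linForce ε J g broken Ω Ωd u w =ᵐ[volume.restrict Ω] 0 → w = 0)
    (hA : ∃ γ : ℝ, 0 < γ ∧ ∀ᵐ x ∂volume.restrict Ω, x ∈ Ω \ Ωd →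
      (stabilityTensor ε J g broken Ω u x ^ 2 -
        γ ^ 2 • (1 : Matrix (Fin n) (Fin n) ℝ)).PosDef) :
    ∃ T : interiorSpace Ω Ωd ≃L[ℝ] interiorSpace Ω Ωd, ∀ w : interiorSpace Ω Ωd,
      (T w : LpSpace ∞ Ω) =ᵐ[volume.restrict Ω]
        linForce ε J g broken Ω Ωd u (w : LpSpace ∞ Ω) := by
  obtain ⟨γ, hγ, hA⟩ := hA
  have hn' : (2 : ℝ) ≤ n := by exact_mod_cast hn
  set μ : Measure (Space n) := volume.restrict Ω
  have : IsFiniteMeasure μ := isFiniteMeasure_restrict.2 hΩb.measure_lt_top.ne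
  -- Any exponent in `(1, 2)` would do: `q < 2 ≤ n` makes the kernel `q`-integrable, and `q > 1`
  -- keeps the conjugate exponent, here `3`, finite, as compactness requires. The value `2` fails
  -- for `n = 2`.
  let q : ℝ≥0∞ := 3 / 2
  have hqr : q.toReal = 3 / 2 := by simp [q]
  have hq : 1 ≤ q := by
    rw [ENNReal.le_div_iff_mul_le (by simp) (by simp)]
    norm_num
  have hq' : q ≠ ∞ := ENNReal.div_ne_top (by simp) (by simp)
  have : Fact (1 ≤ q) := ⟨hq⟩
  have : Fact (q ≠ ∞) := ⟨hq'⟩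
  have : Fact ((1 : ℝ≥0∞) ≤ 3) := ⟨by norm_num⟩
  have : q.HolderConjugate 3 := holderConjugate_three_halves
  have hgm : Measurable (iteratedDeriv 2 g) :=
    (hg.differentiable 2 (by norm_num)).continuous.measurable
  have hMm := stronglyMeasurable_bondKernel (ε := ε) hJ.measurable hgm hbroken hu
  obtain ⟨c, hc, hM⟩ := exists_eLpNorm_bondKernel_le (ε := ε) (Ω := Ω) hJ hg hbroken hu hq hq'
    (by rw [hqr]; linarith)
  obtain ⟨a, ha, hM1⟩ := exists_eLpNorm_bondKernel_le (ε := ε) (Ω := Ω) (q := 1) hJ hg hbroken hu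
    le_rfl (by simp) (by rw [ENNReal.toReal_one]; linarith)
  have hint : ∀ x, Integrable (bondKernel ε J g broken u x) μ := fun x =>
    memLp_one_iff_integrable.1 (hM1 x).1
  let A : Space n → Space n →L[ℝ] Space n := fun x => ∫ y, bondKernel ε J g broken u x y ∂μ
  have hAm : StronglyMeasurable A := hMm.integral_prod_right
  have hAle : ∀ x, ‖A x‖ ≤ a.toReal := fun x => by
    rw [← toReal_enorm]
    refine ENNReal.toReal_mono ha ((enorm_integral_le_lintegral_enorm _).trans ?_)
    rw [← eLpNorm_one_eq_lintegral_enorm]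
    exact (hM1 x).2
  let P := (ContinuousLinearMap.id ℝ (Space n →L[ℝ] Space n)).lpPairing μ q 3
  let κ : Space n → Lp (Space n) 3 μ →L[ℝ] Space n := fun x => P (hM x).1.toLp
  have hκm : StronglyMeasurable κ :=
    -- Measurability in operator norm is inherited from the kernel slices as elements of `L^{3/2}`.
    P.continuous.comp_stronglyMeasurable (stronglyMeasurable_toLp hMm fun x => (hM x).1)
  have hκle : ∀ x, ‖κ x‖ ≤ ‖P‖ * c.toReal := fun x => by
    refine P.le_opNorm_of_le ?_
    rw [Lp.norm_toLp]
    exact ENNReal.toReal_mono hc (hM x).2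
  have hκ : ∀ x w, κ x w = ∫ y, bondKernel ε J g broken u x y (w y) ∂μ := fun x w => by
    rw [ContinuousLinearMap.lpPairing_eq_integral]
    refine integral_congr_ae ?_
    filter_upwards [(hM x).1.coeFn_toLp] with y hy
    simp [hy]
  have hforce : ∀ w : Lp (Space n) ∞ μ, linForce ε J g broken Ω Ωd u w =
      (Ω \ Ωd).indicator fun x => A x (w x) - κ x (lpOfTop 3 w) := by
    intro w
    have h2 : ∀ x, Integrable (fun y => bondKernel ε J g broken u x y (w y)) μ := fun x =>
      (ContinuousLinearMap.id ℝ (Space n →L[ℝ] Space n)).integrable_of_bilin_of_bdd_right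
        ‖w‖ (hint x) (Lp.aestronglyMeasurable w) (ae_norm_le_norm_of_top w)
    ext1 x
    rw [linForce_eq x (hint x) (h2 x)]
    congr 1
    ext1 x
    rw [hκ]
    congr 1
    refine integral_congr_ae ?_
    filter_upwards [coeFn_lpOfTop (p := 3) w] with y hy
    rw [hy]
  have hV : ∀ w, w ∈ interiorSpace Ω Ωd ↔ ∀ᵐ x ∂μ, x ∈ (Ω \ Ωd)ᶜ → w x = 0 := by
    intro w
    change (∀ᵐ x ∂μ, x ∈ Ωd → w x = 0) ↔ _
    refine eventually_congr ?_
    filter_upwards [ae_restrict_mem hΩ] with x hx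
    simp [hx]
  obtain ⟨T, hT⟩ := exists_continuousLinearEquiv_of_injective (p := 3) (by simp)
    (hΩ.diff hΩdm) hAm (stronglyMeasurable_ringInverse hAm) hκm hAle hκle (b := γ⁻¹)
    (V := interiorSpace Ω Ωd)
    (by
      filter_upwards [hA] with x hx hxD
      refine ringInverse_of_antilipschitz hγ fun ξ => ?_
      have : A x = _ := integral_bondKernel x (hint x)
      rw [this]
      exact mul_norm_le_of_posDef (isHermitian_stabilityTensor x) (hx hxD) hγ ξ)
    hV (by
      intro w hw hw0
      have hmem : MemLp w 2 μ := (Lp.memLp w).mono_exponent le_top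
      have h2 : hmem.toLp = 0 := by
        refine hker _ (subset_closure ⟨w, hw, hmem.coeFn_toLp⟩) ?_
        refine (linForce_congr hmem.coeFn_toLp).trans ?_
        rw [hforce]
        filter_upwards [hw0] with x hx
        by_cases hxD : x ∈ Ω \ Ωd
        · rw [Set.indicator_of_mem hxD, hx hxD, sub_self, Pi.zero_apply]
        · rw [Set.indicator_of_notMem hxD, Pi.zero_apply]
      refine Lp.ext ?_
      refine hmem.coeFn_toLp.symm.trans ?_
      rw [h2]
      exact (Lp.coeFn_zero _ _ _).trans (Lp.coeFn_zero _ _ _).symm)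
  exact ⟨T, fun w => (hT w).trans (by rw [hforce])⟩

end Peridynamics

end

theorem mainTheorem4 {n : ℕ} (hn : n = 2 ∨ n = 3)
    {Ω Ωd : Set (Peridynamics.Space n)} (hΩ : IsOpen Ω) (hΩb : Bornology.IsBounded Ω)
    (hΩd : Ωd ⊆ Ω) (hΩdm : MeasurableSet Ωd)
    {ε : ℝ} (hε : 0 < ε)
    {J : ℝ → ℝ} (hJ : Peridynamics.IsInfluenceFunction J)
    {g : ℝ → ℝ} (hg : Peridynamics.IsCohesivePotential g)
    {broken : Set (Peridynamics.Space n × Peridynamics.Space n)} (hbroken : MeasurableSet broken)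
    {v U u : Peridynamics.LpSpace ∞ Ω}
    (hv : v ∈ Peridynamics.interiorSpace Ω Ωd) (hU : U ∈ Peridynamics.boundarySpace Ω Ωd)
    (hu : u = v + U)
    (hker : ∀ w ∈ Peridynamics.interiorL2Closure Ω Ωd,
      Peridynamics.linForce ε J g broken Ω Ωd u w =ᵐ[volume.restrict Ω] 0 → w = 0)
    (hA : ∃ γ : ℝ, 0 < γ ∧ ∀ᵐ x ∂volume.restrict Ω, x ∈ Ω \ Ωd →
      (Peridynamics.stabilityTensor ε J g broken Ω u x ^ 2 -
        γ ^ 2 • (1 : Matrix (Fin n) (Fin n) ℝ)).PosDef) :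
    ∃ T : Peridynamics.interiorSpace Ω Ωd ≃L[ℝ] Peridynamics.interiorSpace Ω Ωd,
      ∀ w : Peridynamics.interiorSpace Ω Ωd,
        (T w : Peridynamics.LpSpace ∞ Ω) =ᵐ[volume.restrict Ω]
          Peridynamics.linForce ε J g broken Ω Ωd u (w : Peridynamics.LpSpace ∞ Ω) := by
  refine Peridynamics.exists_equiv_linForce (by omega) hΩ.measurableSet hΩb hΩdm hJ hg hbroken
    (Lp.stronglyMeasurable u) hker hA
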